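/- Let $n\ge 0$, $d\ge 1$, let $\mathbf q=(q_{ij})_{0\le i,j\le n}$ be a complex matrix with $q_{ij}\neq 0$, $q_{ji}=q_{ij}^{-1}$, $q_{ii}=1$, and let $$\mathcal A=\mathbb C\langle x_0,\dots,x_n\rangle/(x_jx_i-q_{ji}x_ix_j \mid 0\le i<j\le n)$$ be the corresponding quantum space, graded by length, with $d$-Veronese subalgebra $\mathcal A^{(d)}=\bigoplus_{k\ge0}\mathcal A_{kd}$. A term is an ordered monomial $x_0^{a_0}\cdots x_n^{a_n}$, regarded as a word in the free monoid. For $f\in\mathbb C\langle x_0,\dots,x_n\rangle$ let $\mathrm{Nor}(f)$ be the unique linear combination of terms congruent to $f$ modulo the ideal $(x_jx_i-q_{ji}x_ix_j \mid i<j)$. Put $N=\binom{n+d}{d}-1$ and let $w_0<w_1<\dots<w_N$ be the terms of length $d$ in lexicographic order (with $x_0<\dots<x_n$). Let $\mathrm C$ (resp. $\mathrm{MV}$) be the set of pairs $(i,j)$ with $0\le i\le j\le N$ such that the word $w_iw_j$ is (resp. is not) a term. For $0\le i,j\le N$ let $\varphi_{ij}\in\mathbb C^\times$ be the number with $\mathrm{Nor}(w_iw_j)=\varphi_{ij}T$,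 where $T$ is the term of the same multi-degree as $w_iw_j$; this $T$ is $w_{i'}w_{j'}$ for a unique pair $(i',j')\in\mathrm C$. Order the words in $y_0,\dots,y_N$ degree-lexicographically, $y_0\prec\dots\prec y_N$. A Gröbner basis of a two-sided ideal $I$ of $\mathbb C\langle y_0,\dots,y_N\rangle$ is a set $G\subseteq I$ of monic polynomials which generates $I$ as a two-sided ideal and such that the leading monomial of every nonzero $f\in I$ contains the leading monomial of some $g\in G$ as a subword. It is minimal if $G\setminus\{f\}$ is not a Gröbner basis of $I$ for any $f\in G$. A minimal Gröbner basis $G$ is reduced if, for every $f\in G$, no monomial of $f$ contains the leading monomial of an element of $G\setminus\{f\}$ as a subword. Let $V:\mathbb C\langle y_0,\dots,y_N\rangle\to\mathcal A^{(d)}$ be the algebra homomorphism with $V(y_i)=w_i$ for $0\le i\le N$, and let $K=\ker V$. Put $$\Re_1=\{\,y_jy_i-\varphi_{ji}\,y_{i'}y_{j'} \mid 0\le i<j\le N,\ (i',j')\in\mathrm C,\ i'<j',\ \mathrm{Nor}(w_jw_i)=\varphi_{ji}w_{i'}w_{j'},\ y_jy_i\succ y_{i'}y_{j'}\,\},$$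 $$\Re_2=\{\,y_iy_j-\varphi_{ij}\,y_{i'}y_{j'} \mid (i,j)\in\mathrm{MV},\ (i',j')\in\mathrm C,\ i'<j',\ \mathrm{Nor}(w_iw_j)=\varphi_{ij}w_{i'}w_{j'},\ y_iy_j\succ y_{i'}y_{j'}\,\},$$ $$\mathcal R_{\mathbf g}=\{\,y_jy_i-g_{ji}\,y_iy_j \mid 0\le i<j\le N\,\},\qquad g_{ji}=\varphi_{ji}/\varphi_{ij}.$$ Then: 1. $\Re=\Re_1\cup\Re_2$ is the reduced Gröbner basis of $K$; that is, $\Re$ is a reduced Gröbner basis of $K$, and it is the only one. 2. $\Re'=\mathcal R_{\mathbf g}\cup\Re_2$ is a minimal Gröbner basis of $K$. -/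

import Mathlib

namespace QuantumVeronese

/-! ### The free associative algebra and Gröbner bases -/

section Groebner

/-- The free associative algebra `k⟨α⟩`: finite linear combinations of the words of the free
monoid `⟨α⟩`, multiplied by concatenation of words. -/
abbrev FreeAlg (k α : Type*) [Field k] := MonoidAlgebra k (FreeMonoid α)

/-- A word, as an element of the free associative algebra. -/
noncomputable def mon (k : Type*) {α : Type*} [Field k] (u : FreeMonoid α) : FreeAlg k α :=
  MonoidAlgebra.single u 1

theorem mon_mul (k : Type*) {α : Type*} [Field k] (u v : FreeMonoid α) :
    mon k (u * v) = mon k u * mon k v := by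
  simp [mon, MonoidAlgebra.single_mul_single]

theorem mon_one (k α : Type*) [Field k] : mon k (1 : FreeMonoid α) = 1 := rfl

theorem freeAlg_induction {k α : Type*} [Field k] {P : FreeAlg k α → Prop} (f : FreeAlg k α)
    (zero : P 0) (add : ∀ f g, P f → P g → P (f + g))
    (smul : ∀ (c : k) (u : FreeMonoid α), P (c • mon k u)) : P f := by
  induction f using MonoidAlgebra.induction_linear with
  | zero => exact zero
  | add f g hf hg => exact add f g hf hg
  | single u c => simpa [mon] using smul c u

variable {k α : Type*} [Field k] [LinearOrder α]

/-- The degree-lexicographic order on words: first by length, then lexicographically. -/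
def DegLexLT (u v : FreeMonoid α) : Prop :=
  List.Shortlex (· < ·) u.toList v.toList

/-- `u` is the leading monomial of `f` with respect to the degree-lexicographic order. -/
def IsLeadingMonomial (f : FreeAlg k α) (u : FreeMonoid α) : Prop :=
  f.coeff u ≠ 0 ∧ ∀ v, f.coeff v ≠ 0 → v ≠ u → DegLexLT v u

/-- `v` is a subword of `u`. -/
def IsSubword (v u : FreeMonoid α) : Prop := ∃ a b : FreeMonoid α, u = a * v * b

/-- A word is normal modulo `F` if it contains no leading monomial of an element of `F` as a
subword. -/
def IsNormalWord (F : Set (FreeAlg k α)) (u : FreeMonoid α) : Prop :=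
  ∀ f ∈ F, ∀ v, IsLeadingMonomial f v → ¬ IsSubword v u

/-- `f` is monic: its leading coefficient is `1`. -/
def IsMonic (f : FreeAlg k α) : Prop := ∃ u, IsLeadingMonomial f u ∧ f.coeff u = 1

/-- `G` is a Gröbner basis (consisting of monic polynomials) of the two-sided ideal `I`. -/
structure IsGroebnerBasis (G : Set (FreeAlg k α)) (I : TwoSidedIdeal (FreeAlg k α)) : Prop where
  subset : ∀ g ∈ G, g ∈ I
  monic : ∀ g ∈ G, IsMonic g
  generates : TwoSidedIdeal.span G = I
  leading : ∀ f ∈ I, f ≠ 0 → ∃ g ∈ G, ∃ u v,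
    IsLeadingMonomial f u ∧ IsLeadingMonomial g v ∧ IsSubword v u

/-- A Gröbner basis is minimal if no element can be removed from it. -/
def IsMinimalGroebnerBasis (G : Set (FreeAlg k α)) (I : TwoSidedIdeal (FreeAlg k α)) : Prop :=
  IsGroebnerBasis G I ∧ ∀ f ∈ G, ¬ IsGroebnerBasis (G \ {f}) I

/-- A minimal Gröbner basis `G` is reduced if each `f ∈ G` is a linear combination of words that
are normal modulo `G \ {f}`. -/
def IsReducedGroebnerBasis (G : Set (FreeAlg k α)) (I : TwoSidedIdeal (FreeAlg k α)) : Prop :=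
  IsMinimalGroebnerBasis G I ∧ ∀ f ∈ G, ∀ u, f.coeff u ≠ 0 → IsNormalWord (G \ {f}) u

end Groebner

/-! ### Quantum spaces -/

section QuantumSpace

variable {m : ℕ}

/-- Multiplicatively anti-symmetric complex matrices. -/
def IsMultAntisymm (q : Matrix (Fin m) (Fin m) ℂ) : Prop :=
  (∀ i j, q i j ≠ 0) ∧ (∀ i j, q j i = (q i j)⁻¹) ∧ ∀ i, q i i = 1

/-- The `i`-th free generator of `ℂ⟨x_0, …, x_{m-1}⟩`. -/
noncomputable def gen (i : Fin m) : FreeAlg ℂ (Fin m) := mon ℂ (FreeMonoid.of i)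

/-- The relations `x_j x_i - q_{ji} x_i x_j`, `i < j`, of the quantum space defined by `q`. -/
def quantumRels (q : Matrix (Fin m) (Fin m) ℂ) : Set (FreeAlg ℂ (Fin m)) :=
  {f | ∃ i j, i < j ∧ f = gen j * gen i - q j i • (gen i * gen j)}

/-- The two-sided ideal generated by the quantum relations. -/
noncomputable def quantumIdeal (q : Matrix (Fin m) (Fin m) ℂ) :
    TwoSidedIdeal (FreeAlg ℂ (Fin m)) :=
  TwoSidedIdeal.span (quantumRels q)

/-- The quantum space `ℂ⟨x_0, …, x_{m-1}⟩ / (quantumRels q)`. -/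
abbrev QuantumSpace (q : Matrix (Fin m) (Fin m) ℂ) := (quantumIdeal q).ringCon.Quotient

/-- The canonical projection from the free algebra onto the quantum space. -/
noncomputable def proj (q : Matrix (Fin m) (Fin m) ℂ) :
    FreeAlg ℂ (Fin m) →ₐ[ℂ] QuantumSpace q :=
  RingCon.mkₐ ℂ (quantumIdeal q).ringCon

/-- The homogeneous component of degree `r` of the quantum space: the span of the classes of the
words of length `r`. -/
noncomputable def homogeneousPart (q : Matrix (Fin m) (Fin m) ℂ) (r : ℕ) :
    Submodule ℂ (QuantumSpace q) :=
  Submodule.span ℂ {a | ∃ u : FreeMonoid (Fin m), u.length = r ∧ a = proj q (mon ℂ u)}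

theorem proj_mon_mem (q : Matrix (Fin m) (Fin m) ℂ) (u : FreeMonoid (Fin m)) :
    proj q (mon ℂ u) ∈ homogeneousPart q u.length :=
  Submodule.subset_span ⟨u, rfl, rfl⟩

theorem homogeneousPart_mul_le (q : Matrix (Fin m) (Fin m) ℂ) (r s : ℕ) :
    homogeneousPart q r * homogeneousPart q s ≤ homogeneousPart q (r + s) := by
  unfold homogeneousPart
  rw [Submodule.span_mul_span, Submodule.span_le]
  rintro _ ⟨_, ⟨u, hu, rfl⟩, _, ⟨v, hv, rfl⟩, rfl⟩
  refine Submodule.subset_span ⟨u * v, ?_, ?_⟩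
  · rw [FreeMonoid.length_mul, hu, hv]
  · rw [mon_mul, map_mul]

/-- The `d`-Veronese subalgebra: the sum of the homogeneous components of degree `r * d`, `r ≥ 0`,
of the quantum space. -/
noncomputable def veronese (q : Matrix (Fin m) (Fin m) ℂ) (d : ℕ) :
    Subalgebra ℂ (QuantumSpace q) :=
  Submodule.toSubalgebra (⨆ r : ℕ, homogeneousPart q (r * d))
    (by
      refine (le_iSup (fun r : ℕ => homogeneousPart q (r * d)) 0) ?_
      have h := proj_mon_mem q 1
      rw [mon_one, map_one] at h
      simpa using h)
    (by
      intro x y hx hy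
      have h : (⨆ r : ℕ, homogeneousPart q (r * d)) * (⨆ r : ℕ, homogeneousPart q (r * d)) ≤
          ⨆ r : ℕ, homogeneousPart q (r * d) := by
        rw [Submodule.iSup_mul]
        refine iSup_le fun r => ?_
        rw [Submodule.mul_iSup]
        refine iSup_le fun s => (homogeneousPart_mul_le q _ _).trans ?_
        rw [← add_mul]
        exact le_iSup (fun r : ℕ => homogeneousPart q (r * d)) (r + s)
      exact h (Submodule.mul_mem_mul hx hy))

end QuantumSpace

/-! ### Ordered monomials and normal forms -/

section NormalForm

variable {m : ℕ}

/-- Ordered monomials (terms) `x_0 ^ a_0 ⋯ x_{m-1} ^ a_{m-1}`: the letters occur in weakly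
increasing order. -/
def IsTerm (u : FreeMonoid (Fin m)) : Prop := u.toList.Pairwise (· ≤ ·)

/-- The term with the same multi-degree as the word `u`. -/
def sortedWord (u : FreeMonoid (Fin m)) : FreeMonoid (Fin m) :=
  FreeMonoid.ofList ((u.toList : Multiset (Fin m)).sort)

/-- The coefficient produced by sorting a word with the rules `x_a x_b = q_{ab} x_b x_a`, `b < a`:
the product of `q_{ab}` over all occurrences of a letter `a` before a smaller letter `b`. -/
def sortCoeffList (q : Matrix (Fin m) (Fin m) ℂ) : List (Fin m) → ℂ
  | [] => 1
  | a :: l => (l.map fun b => if b < a then q a b else 1).prod * sortCoeffList q l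

/-- The coefficient `ζ_u` with `u = ζ_u T` in the quantum space, `T` being the term with the
multi-degree of `u`. -/
def sortCoeff (q : Matrix (Fin m) (Fin m) ℂ) (u : FreeMonoid (Fin m)) : ℂ :=
  sortCoeffList q u.toList

/-- The normal form modulo the quantum relations; see `nor_eq_iff` for its characterization. -/
noncomputable def nor (q : Matrix (Fin m) (Fin m) ℂ) :
    FreeAlg ℂ (Fin m) →ₗ[ℂ] FreeAlg ℂ (Fin m) :=
  (Finsupp.linearCombination ℂ fun u => sortCoeff q u • mon ℂ (sortedWord u)) ∘ₗ
    (MonoidAlgebra.coeffLinearEquiv ℂ).toLinearMap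

theorem nor_mon (q : Matrix (Fin m) (Fin m) ℂ) (u : FreeMonoid (Fin m)) :
    nor q (mon ℂ u) = sortCoeff q u • mon ℂ (sortedWord u) := by
  simp [nor, mon]

theorem sortedWord_isTerm (u : FreeMonoid (Fin m)) : IsTerm (sortedWord u) := by
  simpa [IsTerm, sortedWord] using Multiset.pairwise_sort (u.toList : Multiset (Fin m)) (· ≤ ·)

theorem sortCoeffList_of_pairwise (q : Matrix (Fin m) (Fin m) ℂ) (l : List (Fin m))
    (h : l.Pairwise (· ≤ ·)) : sortCoeffList q l = 1 := by
  induction l with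
  | nil => rfl
  | cons a l ih =>
    rw [List.pairwise_cons] at h
    rw [sortCoeffList, ih h.2, mul_one]
    refine List.prod_eq_one ?_
    intro c hc
    obtain ⟨b, hb, rfl⟩ := List.mem_map.1 hc
    rw [if_neg (not_lt.2 (h.1 b hb))]

theorem sortedWord_of_isTerm (u : FreeMonoid (Fin m)) (h : IsTerm u) : sortedWord u = u := by
  have hp : ((u.toList : Multiset (Fin m)).sort).Perm u.toList :=
    Multiset.coe_eq_coe.1 (Multiset.sort_eq _ _)
  have := hp.eq_of_pairwise (le := (· ≤ ·)) (fun _ _ _ _ h1 h2 => le_antisymm h1 h2)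
    (Multiset.pairwise_sort _ _) h
  simp [sortedWord, this]

theorem nor_term (q : Matrix (Fin m) (Fin m) ℂ) (u : FreeMonoid (Fin m)) (h : IsTerm u) :
    nor q (mon ℂ u) = mon ℂ u := by
  rw [nor_mon, sortedWord_of_isTerm u h, sortCoeff, sortCoeffList_of_pairwise q _ h, one_smul]

theorem sortCoeffList_ne_zero (q : Matrix (Fin m) (Fin m) ℂ) (hq : ∀ i j, q i j ≠ 0)
    (l : List (Fin m)) : sortCoeffList q l ≠ 0 := by
  induction l with
  | nil => exact one_ne_zero
  | cons a l ih =>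
    refine mul_ne_zero (List.prod_ne_zero ?_) ih
    intro h
    obtain ⟨b, -, hb⟩ := List.mem_map.1 h
    split_ifs at hb
    · exact hq _ _ hb
    · exact one_ne_zero hb

theorem proj_eq_zero_iff (q : Matrix (Fin m) (Fin m) ℂ) (f : FreeAlg ℂ (Fin m)) :
    proj q f = 0 ↔ f ∈ quantumIdeal q := by
  rw [TwoSidedIdeal.mem_iff]
  exact RingCon.eq _

theorem proj_swap (q : Matrix (Fin m) (Fin m) ℂ) {i j : Fin m} (h : i < j) :
    proj q (gen j) * proj q (gen i) = q j i • (proj q (gen i) * proj q (gen j)) := by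
  rw [← sub_eq_zero, ← map_mul, ← map_mul, ← map_smul, ← map_sub, proj_eq_zero_iff]
  exact TwoSidedIdeal.subset_span ⟨i, j, h, rfl⟩

theorem proj_perm (q : Matrix (Fin m) (Fin m) ℂ) (hq : ∀ i j, q i j ≠ 0) {l l' : List (Fin m)}
    (h : l.Perm l') :
    sortCoeffList q l' • proj q (mon ℂ (FreeMonoid.ofList l)) =
      sortCoeffList q l • proj q (mon ℂ (FreeMonoid.ofList l')) := by
  have hcons : ∀ (a : Fin m) (l : List (Fin m)), proj q (mon ℂ (FreeMonoid.ofList (a :: l))) =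
      proj q (gen a) * proj q (mon ℂ (FreeMonoid.ofList l)) := by
    intro a l
    rw [FreeMonoid.ofList_cons, mon_mul, map_mul, gen]
  induction h with
  | nil => rfl
  | cons a h ih =>
    rename_i l l'
    rw [hcons, hcons, sortCoeffList, sortCoeffList, ((h.map _).prod_eq), mul_smul, mul_smul,
      ← mul_smul_comm, ih, mul_smul_comm]
  | swap a b l =>
    rw [hcons, hcons, hcons, hcons, ← mul_assoc, ← mul_assoc]
    simp only [sortCoeffList, List.map_cons, List.prod_cons]
    rcases lt_trichotomy a b with hab | rfl | hab
    · rw [proj_swap q hab, if_neg hab.not_gt, if_pos hab, smul_mul_assoc, smul_smul]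
      congr 1
      ring
    · rfl
    · rw [proj_swap q hab, if_neg hab.not_gt, if_pos hab, smul_mul_assoc, smul_smul]
      congr 1
      ring
  | trans _ _ ih1 ih2 =>
    rename_i l1 l2 l3 _ _
    have h0 := sortCoeffList_ne_zero q hq l2
    refine smul_right_injective _ h0 ?_
    simp only
    rw [smul_comm, ih1, smul_comm, ih2, smul_comm]

theorem sortCoeffList_relation (q : Matrix (Fin m) (Fin m) ℂ) {i j : Fin m} (h : i < j)
    (a b : List (Fin m)) :
    sortCoeffList q (a ++ j :: i :: b) = q j i * sortCoeffList q (a ++ i :: j :: b) := by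
  induction a with
  | nil =>
    simp only [List.nil_append, sortCoeffList, List.map_cons, List.prod_cons, if_pos h,
      if_neg h.not_gt]
    ring
  | cons c a ih =>
    simp only [List.cons_append, sortCoeffList]
    have hp : (a ++ j :: i :: b).Perm (a ++ i :: j :: b) :=
      (List.Perm.swap i j b).append_left a
    rw [ih, (hp.map _).prod_eq]
    ring

theorem nor_relation (q : Matrix (Fin m) (Fin m) ℂ) {i j : Fin m} (h : i < j)
    (a b : FreeMonoid (Fin m)) :
    nor q (mon ℂ a * (gen j * gen i - q j i • (gen i * gen j)) * mon ℂ b) = 0 := by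
  have h1 : mon ℂ a * (gen j * gen i - q j i • (gen i * gen j)) * mon ℂ b =
      mon ℂ (a * (FreeMonoid.of j * FreeMonoid.of i) * b) -
        q j i • mon ℂ (a * (FreeMonoid.of i * FreeMonoid.of j) * b) := by
    simp only [mon_mul, gen, mul_sub, sub_mul, mul_smul_comm, smul_mul_assoc]
  have h2 : sortCoeff q (a * (FreeMonoid.of j * FreeMonoid.of i) * b) =
      q j i * sortCoeff q (a * (FreeMonoid.of i * FreeMonoid.of j) * b) := by
    simpa [sortCoeff] using sortCoeffList_relation q h a.toList b.toList
  have h3 : sortedWord (a * (FreeMonoid.of j * FreeMonoid.of i) * b) =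
      sortedWord (a * (FreeMonoid.of i * FreeMonoid.of j) * b) := by
    have hp : ((a * (FreeMonoid.of j * FreeMonoid.of i) * b).toList).Perm
        ((a * (FreeMonoid.of i * FreeMonoid.of j) * b).toList) := by
      simpa using (List.Perm.swap i j b.toList).append_left a.toList
    rw [sortedWord, sortedWord, Multiset.coe_eq_coe.2 hp]
  rw [h1, map_sub, map_smul, nor_mon, nor_mon, h2, h3, smul_smul, sub_self]

theorem nor_eq_zero (q : Matrix (Fin m) (Fin m) ℂ) {f : FreeAlg ℂ (Fin m)}
    (hf : f ∈ quantumIdeal q) : nor q f = 0 := by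
  rw [quantumIdeal, TwoSidedIdeal.mem_span_iff_mem_addSubgroup_closure] at hf
  induction hf using AddSubgroup.closure_induction with
  | zero => exact map_zero _
  | add x y _ _ hx hy => rw [map_add, hx, hy, add_zero]
  | neg x _ hx => rw [map_neg, hx, neg_zero]
  | mem x hx =>
    obtain ⟨_, ⟨f, -, _, ⟨i, j, hij, rfl⟩, rfl⟩, g, -, rfl⟩ := hx
    dsimp only
    induction f using freeAlg_induction with
    | zero => simp
    | add f f' hf hf' =>
      simp only [add_mul, map_add] at hf hf' ⊢
      rw [hf, hf', add_zero]
    | smul c u =>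
      induction g using freeAlg_induction with
      | zero => simp
      | add g g' hg hg' =>
        simp only [mul_add, map_add] at hg hg' ⊢
        rw [hg, hg', add_zero]
      | smul c' v =>
        simp only [smul_mul_assoc, mul_smul_comm, map_smul]
        rw [nor_relation q hij, smul_zero, smul_zero]

/-- `nor q f` is the unique linear combination of terms that is congruent to `f` modulo the ideal
generated by the quantum relations. -/
theorem nor_eq_iff (q : Matrix (Fin m) (Fin m) ℂ) (hq : ∀ i j, q i j ≠ 0)
    (f h : FreeAlg ℂ (Fin m)) :
    nor q f = h ↔ h ∈ Submodule.span ℂ (mon ℂ '' {u | IsTerm u}) ∧ f - h ∈ quantumIdeal q := by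
  constructor
  · rintro rfl
    induction f using freeAlg_induction with
    | zero => simp
    | add f g hf hg =>
      refine ⟨by rw [map_add]; exact Submodule.add_mem _ hf.1 hg.1, ?_⟩
      rw [map_add, add_sub_add_comm]
      exact TwoSidedIdeal.add_mem _ hf.2 hg.2
    | smul c u =>
      rw [map_smul, nor_mon]
      refine ⟨Submodule.smul_mem _ _ (Submodule.smul_mem _ _ (Submodule.subset_span
        ⟨_, sortedWord_isTerm u, rfl⟩)), ?_⟩
      have hp : u.toList.Perm (sortedWord u).toList := by
        simpa [sortedWord] using
          (Multiset.coe_eq_coe.1 (Multiset.sort_eq (u.toList : Multiset (Fin m)) (· ≤ ·))).symm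
      have h1 := proj_perm q hq hp
      rw [sortCoeffList_of_pairwise q _ (sortedWord_isTerm u), one_smul] at h1
      rw [← proj_eq_zero_iff, map_sub, map_smul, map_smul, map_smul, sub_eq_zero]
      exact congrArg (c • ·) h1
  · rintro ⟨h1, h2⟩
    have h3 : nor q h = h := by
      clear h2
      induction h1 using Submodule.span_induction with
      | mem x hx =>
        obtain ⟨u, hu, rfl⟩ := hx
        exact nor_term q u hu
      | zero => exact map_zero _
      | add x y _ _ hx hy => rw [map_add, hx, hy]
      | smul c x _ hx => rw [map_smul, hx]
    have h4 := nor_eq_zero q h2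
    rw [map_sub, h3, sub_eq_zero] at h4
    exact h4

end NormalForm

/-! ### Veronese map -/

section Veronese

variable (n d : ℕ)

/-- The finite set of terms of length `d` in the variables `x_0, …, x_n`, written as lists. -/
def terms : Finset (List (Fin (n + 1))) :=
  (Finset.univ : Finset (Sym (Fin (n + 1)) d)).image fun s => s.1.sort

theorem mem_terms (l : List (Fin (n + 1))) :
    l ∈ terms n d ↔ IsTerm (FreeMonoid.ofList l) ∧ l.length = d := by
  simp only [terms, Finset.mem_image, Finset.mem_univ, true_and, IsTerm, FreeMonoid.toList_ofList]
  constructor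
  · rintro ⟨s, rfl⟩
    exact ⟨Multiset.pairwise_sort _ _, by simp⟩
  · rintro ⟨h1, h2⟩
    refine ⟨⟨(l : Multiset (Fin (n + 1))), by simpa using h2⟩, ?_⟩
    exact (Multiset.coe_eq_coe.1 (Multiset.sort_eq _ _)).eq_of_pairwise (le := (· ≤ ·))
      (fun _ _ _ _ h1 h2 => le_antisymm h1 h2) (Multiset.pairwise_sort _ _) h1

theorem card_terms : (terms n d).card = (n + d).choose d := by
  rw [terms, Finset.card_image_of_injective, Finset.card_univ, Sym.card_sym_eq_choose,
    Fintype.card_fin]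
  · congr 1
    omega
  · intro s t h
    have := congrArg (fun l : List (Fin (n + 1)) => (l : Multiset (Fin (n + 1)))) h
    simp only [Multiset.sort_eq] at this
    exact Sym.coe_injective this

/-- The terms `w_0 < w_1 < ⋯ < w_N` of length `d` in `x_0, …, x_n`, enumerated in increasing
lexicographic order; here `N + 1 = (n + d).choose d`. -/
noncomputable def w (i : Fin ((n + d).choose d)) : FreeMonoid (Fin (n + 1)) :=
  FreeMonoid.ofList ((terms n d).orderEmbOfFin (card_terms n d) i)

theorem w_isTerm (i : Fin ((n + d).choose d)) : IsTerm (w n d i) :=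
  ((mem_terms n d _).1 (Finset.orderEmbOfFin_mem _ (card_terms n d) i)).1

theorem w_length (i : Fin ((n + d).choose d)) : (w n d i).length = d :=
  ((mem_terms n d _).1 (Finset.orderEmbOfFin_mem _ (card_terms n d) i)).2

theorem exists_w_eq {u : FreeMonoid (Fin (n + 1))} (h1 : IsTerm u) (h2 : u.length = d) :
    ∃ i, w n d i = u := by
  have h : u.toList ∈ terms n d := (mem_terms n d _).2 ⟨h1, h2⟩
  rw [← Finset.mem_coe, ← Finset.range_orderEmbOfFin _ (card_terms n d)] at h
  obtain ⟨i, hi⟩ := h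
  exact ⟨i, by rw [w, hi, FreeMonoid.ofList_toList]⟩

theorem w_degLexLT {i j : Fin ((n + d).choose d)} (h : i < j) :
    DegLexLT (w n d i) (w n d j) := by
  refine List.Shortlex.of_lex ((w_length n d i).trans (w_length n d j).symm) ?_
  exact ((terms n d).orderEmbOfFin (card_terms n d)).strictMono h

variable {n d}

/-- The pairs `(i, j)`, `i ≤ j`, such that `w_i w_j` is a term. -/
def InC (i j : Fin ((n + d).choose d)) : Prop := i ≤ j ∧ IsTerm (w n d i * w n d j)

/-- The pairs `(i, j)`, `i ≤ j`, such that `w_i w_j` is not a term. -/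
def InMV (i j : Fin ((n + d).choose d)) : Prop := i ≤ j ∧ ¬ IsTerm (w n d i * w n d j)

variable (q : Matrix (Fin (n + 1)) (Fin (n + 1)) ℂ)

/-- The nonzero coefficient `φ_{ij}` in `Nor (w_i w_j) = φ_{ij} T`, `T` a term. -/
noncomputable def phi (i j : Fin ((n + d).choose d)) : ℂ := sortCoeff q (w n d i * w n d j)

theorem nor_w_mul_w (i j : Fin ((n + d).choose d)) :
    nor q (mon ℂ (w n d i * w n d j)) = phi q i j • mon ℂ (sortedWord (w n d i * w n d j)) :=
  nor_mon q _

variable (d)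

/-- The deformation matrix `g` with entries `g_{ji} = φ_{ji} / φ_{ij}`. -/
noncomputable def veroneseMatrix :
    Matrix (Fin ((n + d).choose d)) (Fin ((n + d).choose d)) ℂ :=
  Matrix.of fun j i => phi q j i / phi q i j

theorem veroneseMatrix_isMultAntisymm (hq : IsMultAntisymm q) :
    IsMultAntisymm (veroneseMatrix d q) := by
  have h : ∀ i j : Fin ((n + d).choose d), phi q i j ≠ 0 := fun i j =>
    sortCoeffList_ne_zero q hq.1 _
  refine ⟨fun i j => div_ne_zero (h i j) (h j i), fun i j => ?_, fun i => div_self (h i i)⟩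
  simp [veroneseMatrix]

/-- The algebra homomorphism `V : ℂ⟨y_0, …, y_N⟩ → 𝒜^{(d)}` with `y_i ↦ w_i`. -/
noncomputable def veroneseLift :
    FreeAlg ℂ (Fin ((n + d).choose d)) →ₐ[ℂ] veronese q d :=
  MonoidAlgebra.lift ℂ (veronese q d) (FreeMonoid (Fin ((n + d).choose d)))
    (FreeMonoid.lift fun i => ⟨proj q (mon ℂ (w n d i)), by
      have h := proj_mon_mem q (w n d i)
      rw [w_length] at h
      refine le_iSup (fun r : ℕ => homogeneousPart q (r * d)) 1 ?_
      simpa using h⟩)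

theorem veroneseLift_gen (i : Fin ((n + d).choose d)) :
    (veroneseLift d q (gen i) : QuantumSpace q) = proj q (mon ℂ (w n d i)) := by
  simp [veroneseLift, gen, mon]

/-- The kernel `K` of `V`. -/
noncomputable def veroneseKer : TwoSidedIdeal (FreeAlg ℂ (Fin ((n + d).choose d))) :=
  TwoSidedIdeal.ker (veroneseLift d q)

/-- The binomials `F_{ji} = y_j y_i - φ_{ji} y_{i'} y_{j'}`, `i < j`, where `(i', j')` is the pair
with `w_{i'} w_{j'}` a term and `Nor (w_j w_i) = φ_{ji} w_{i'} w_{j'}`. -/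
def Re₁ : Set (FreeAlg ℂ (Fin ((n + d).choose d))) :=
  {F | ∃ i j i' j', i < j ∧ i' < j' ∧ InC i' j' ∧ phi q j i ≠ 0 ∧
    nor q (mon ℂ (w n d j * w n d i)) = phi q j i • mon ℂ (w n d i' * w n d j') ∧
    DegLexLT (FreeMonoid.of i' * FreeMonoid.of j') (FreeMonoid.of j * FreeMonoid.of i) ∧
    F = gen j * gen i - phi q j i • (gen i' * gen j')}

/-- The binomials `F_{ij} = y_i y_j - φ_{ij} y_{i'} y_{j'}`, `(i, j) ∈ MV(n, d)`, where `(i', j')`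
is the pair with `w_{i'} w_{j'}` a term and `Nor (w_i w_j) = φ_{ij} w_{i'} w_{j'}`. -/
def Re₂ : Set (FreeAlg ℂ (Fin ((n + d).choose d))) :=
  {F | ∃ i j i' j', InMV i j ∧ i' < j' ∧ InC i' j' ∧ phi q i j ≠ 0 ∧
    nor q (mon ℂ (w n d i * w n d j)) = phi q i j • mon ℂ (w n d i' * w n d j') ∧
    DegLexLT (FreeMonoid.of i' * FreeMonoid.of j') (FreeMonoid.of i * FreeMonoid.of j) ∧
    F = gen i * gen j - phi q i j • (gen i' * gen j')}

end Veronese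
end QuantumVeronese

/-! Substituting `y_i ↦ w_i` sends a word in the `y_i` to a word in the `x_i`, whose normal form is
a nonzero multiple of one term. Hence `K` is the kernel of `nor` composed with this substitution
(`mem_veroneseKer_iff`), and the proof determines its leading monomials.

Two order facts do this. First, the `w_i` have equal length and increase lexicographically, so the
substitution is lexicographically increasing on words of equal length, while a sorted word is the
least among its rearrangements. So among words whose images have a given multi-degree, one with a
term as image is the least (`eq_or_degLexLT_of_sortedWord_eq`). Taking the coefficient of that term
in the normal form shows that the leading monomial of a nonzero element of `K` never has a term as
image. Second, being a term is a condition on neighbours: an image that is not a term comes from a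
word containing some `y_i y_j` with `(i, j) ∉ C` (`exists_not_inC_of_not_isTerm`).

Therefore any monic elements of `K` whose leading monomials include every such `y_i y_j` form a
Gröbner basis (`isGroebnerBasis_veroneseKer`). The pairs outside `C` are those with `j < i` and
those in `MV`, and both sets of binomials contain exactly one element for each. Their leading
monomials are distinct words of length two, whence minimality. The tails in `Re₁` and `Re₂` are
words from `C`, whence reducedness; uniqueness holds for reduced Gröbner bases of any ideal. -/

namespace QuantumVeronese

/-! ### Subwords and the degree-lexicographic order -/

section DegLex

variable {α : Type*}

theorem IsSubword.trans {u v w : FreeMonoid α} (h : IsSubword u v) (h' : IsSubword v w) :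
    IsSubword u w := by
  obtain ⟨a, b, rfl⟩ := h
  obtain ⟨c, e, rfl⟩ := h'
  exact ⟨c * a, b * e, by simp only [mul_assoc]⟩

theorem IsSubword.length_le {u v : FreeMonoid α} (h : IsSubword u v) : u.length ≤ v.length := by
  obtain ⟨a, b, rfl⟩ := h
  simp only [FreeMonoid.length_mul]
  omega

theorem IsSubword.eq_of_length_le {u v : FreeMonoid α} (h : IsSubword u v)
    (hl : v.length ≤ u.length) : u = v := by
  obtain ⟨a, b, rfl⟩ := h
  simp only [FreeMonoid.length_mul] at hl
  rw [FreeMonoid.length_eq_zero.1 (show a.length = 0 by omega),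
    FreeMonoid.length_eq_zero.1 (show b.length = 0 by omega), one_mul, mul_one]

theorem IsSubword.antisymm {u v : FreeMonoid α} (h : IsSubword u v) (h' : IsSubword v u) : u = v :=
  h.eq_of_length_le h'.length_le

/-- The key whose order is the degree-lexicographic order. -/
def degLexKey (u : FreeMonoid α) : ℕ ×ₗ List α := toLex (u.length, u.toList)

theorem degLexKey_injective : Function.Injective (degLexKey : FreeMonoid α → _) := fun u v h => by
  have := congrArg (fun x => (ofLex x).2) h
  exact FreeMonoid.toList.injective this

variable [LinearOrder α]

theorem degLexLT_iff_key {u v : FreeMonoid α} : DegLexLT u v ↔ degLexKey u < degLexKey v := by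
  rw [degLexKey, degLexKey, Prod.Lex.toLex_lt_toLex]
  exact List.shortlex_def

theorem DegLexLT.trans {u v w : FreeMonoid α} (h : DegLexLT u v) (h' : DegLexLT v w) :
    DegLexLT u w := by
  rw [degLexLT_iff_key] at *
  exact h.trans h'

theorem DegLexLT.irrefl (u : FreeMonoid α) : ¬ DegLexLT u u := by
  rw [degLexLT_iff_key]
  exact lt_irrefl _

theorem degLexLT_of_ne_of_not {u v : FreeMonoid α} (h : u ≠ v) (h' : ¬ DegLexLT v u) :
    DegLexLT u v := by
  rw [degLexLT_iff_key] at *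
  exact lt_of_le_of_ne (not_lt.1 h') fun h0 => h (degLexKey_injective h0)

/-- Equal lengths exclude comparison by proper prefix, so the comparison is settled at a letter
present in both lists, before `s` and `t` begin. -/
theorem lex_append_of_length_eq {l l' : List α} (h : List.Lex (· < ·) l l')
    (hl : l.length = l'.length) (s t : List α) : List.Lex (· < ·) (l ++ s) (l' ++ t) := by
  induction h with
  | nil => simp at hl
  | cons _ ih => exact List.Lex.cons (ih (by simpa using hl))
  | rel h => exact List.Lex.rel h

theorem DegLexLT.mul_mul {u v : FreeMonoid α} (h : DegLexLT u v) (a b : FreeMonoid α) :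
    DegLexLT (a * u * b) (a * v * b) := by
  rcases List.shortlex_def.1 h with h | ⟨h1, h2⟩
  · refine List.Shortlex.of_length_lt ?_
    simpa using h
  · refine List.Shortlex.of_lex (by simpa using h1) ?_
    simpa using List.Lex.append_left _ (lex_append_of_length_eq h2 h1 b.toList b.toList) a.toList

theorem IsSubword.not_degLexLT {u v : FreeMonoid α} (h : IsSubword u v) : ¬ DegLexLT v u := by
  intro h'
  have hl : v.length ≤ u.length := by
    rcases List.shortlex_def.1 h' with h' | h'
    · exact h'.le
    · exact h'.1.le
  obtain rfl := h.eq_of_length_le hl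
  exact DegLexLT.irrefl _ h'

end DegLex

/-! ### Gröbner bases: generation, minimality, uniqueness of the reduced one -/

section Groebner

variable {k α : Type*} [Field k]

theorem coeff_mon_mul_mul_mon (a b v : FreeMonoid α) (g : FreeAlg k α) :
    (mon k a * g * mon k b).coeff (a * v * b) = g.coeff v := by
  rw [mon, mon, MonoidAlgebra.coeff_mul_single_eq_coeff_mul (m₂ := a * v), mul_one,
    MonoidAlgebra.coeff_single_mul_eq_mul_coeff (m₂ := v), one_mul]
  · simp
  · simp

theorem exists_of_coeff_mon_mul_mul_mon_ne_zero {a b u : FreeMonoid α} {g : FreeAlg k α}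
    (h : (mon k a * g * mon k b).coeff u ≠ 0) : ∃ v, u = a * v * b := by
  by_contra! h'
  by_cases hb : ∃ v, v * b = u
  · obtain ⟨v, rfl⟩ := hb
    rw [mon, mon, MonoidAlgebra.coeff_mul_single_eq_coeff_mul (m₂ := v) (by simp), mul_one] at h
    refine h (MonoidAlgebra.coeff_single_mul_of_forall_mul_ne _ _ ?_)
    rintro v' rfl
    exact h' v' rfl
  · push Not at hb
    exact h (MonoidAlgebra.coeff_mul_single_of_forall_mul_ne _ _ hb)

variable [LinearOrder α]

theorem IsLeadingMonomial.unique {f : FreeAlg k α} {u v : FreeMonoid α}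
    (hu : IsLeadingMonomial f u) (hv : IsLeadingMonomial f v) : u = v := by
  by_contra h
  exact DegLexLT.irrefl _ ((hu.2 v hv.1 (Ne.symm h)).trans (hv.2 u hu.1 h))

theorem exists_isLeadingMonomial {f : FreeAlg k α} (hf : f ≠ 0) :
    ∃ u, IsLeadingMonomial f u := by
  have hs : f.coeff.support.Nonempty := by
    rw [Finsupp.support_nonempty_iff]
    simpa using hf
  obtain ⟨u, hu, hmax⟩ := Finset.exists_max_image _ degLexKey hs
  refine ⟨u, Finsupp.mem_support_iff.1 hu, fun v hv hvu => degLexLT_of_ne_of_not hvu ?_⟩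
  rw [degLexLT_iff_key]
  exact not_lt.2 (hmax v (Finsupp.mem_support_iff.2 hv))

theorem IsMonic.coeff_eq_one {f : FreeAlg k α} (h : IsMonic f) {u : FreeMonoid α}
    (hu : IsLeadingMonomial f u) : f.coeff u = 1 := by
  obtain ⟨v, hv, h1⟩ := h
  rwa [hu.unique hv]

/-- Monic elements of an ideal whose leading monomials divide all leading monomials of the ideal
generate it. -/
theorem span_eq_of_leading [WellFoundedLT α] {G : Set (FreeAlg k α)}
    {I : TwoSidedIdeal (FreeAlg k α)} (hsub : ∀ g ∈ G, g ∈ I) (hmonic : ∀ g ∈ G, IsMonic g)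
    (hlead : ∀ f ∈ I, f ≠ 0 → ∃ g ∈ G, ∃ u v,
      IsLeadingMonomial f u ∧ IsLeadingMonomial g v ∧ IsSubword v u) :
    TwoSidedIdeal.span G = I := by
  refine le_antisymm (TwoSidedIdeal.span_le.2 hsub) ?_
  have hwf : WellFounded (DegLexLT : FreeMonoid α → FreeMonoid α → Prop) :=
    InvImage.wf FreeMonoid.toList (List.Shortlex.wf (wellFounded_lt (α := α)))
  have key : ∀ u : FreeMonoid α, ∀ f ∈ I, IsLeadingMonomial f u → f ∈ TwoSidedIdeal.span G := by
    intro u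
    induction u using hwf.induction with
    | _ u ih =>
    intro f hf hfu
    have hf0 : f ≠ 0 := by
      rintro rfl
      exact hfu.1 rfl
    obtain ⟨g, hg, u', v, hu', hv, a, b, hab⟩ := hlead f hf hf0
    obtain rfl := hfu.unique hu'
    have hmem : ∀ J : TwoSidedIdeal (FreeAlg k α), g ∈ J →
        f.coeff u • (mon k a * g * mon k b) ∈ J := fun J hJ => by
      rw [← smul_mul_assoc, ← smul_mul_assoc]
      exact J.mul_mem_right _ _ (J.mul_mem_left _ _ hJ)
    -- One division step: `g` is monic, so this multiple of it cancels the leading term of `f`.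
    set r := f - f.coeff u • (mon k a * g * mon k b) with hr
    have hrI : r ∈ I := I.sub_mem hf (hmem I (hsub g hg))
    have hfr : f = r + f.coeff u • (mon k a * g * mon k b) := by rw [hr, sub_add_cancel]
    have hru : r.coeff u = 0 := by
      rw [hr, MonoidAlgebra.coeff_sub, Finsupp.sub_apply, MonoidAlgebra.coeff_smul_apply]
      conv_lhs => rw [hab]
      rw [coeff_mon_mul_mul_mon, (hmonic g hg).coeff_eq_one hv, smul_eq_mul, mul_one, sub_self]
    rw [hfr]
    refine TwoSidedIdeal.add_mem _ ?_ (hmem _ (TwoSidedIdeal.subset_span hg))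
    by_cases hr0 : r = 0
    · rw [hr0]
      exact TwoSidedIdeal.zero_mem _
    obtain ⟨t, ht⟩ := exists_isLeadingMonomial hr0
    refine ih t ?_ r hrI ht
    have htu : t ≠ u := by
      rintro rfl
      exact ht.1 hru
    -- The leading monomial of `r` comes either from the multiple of `g`, where it lies below `a * v
    -- * b = u`, or from `f`, where it lies below `u` already.
    by_cases hft : f.coeff t = 0
    · have h1 := ht.1
      rw [hr, MonoidAlgebra.coeff_sub, Finsupp.sub_apply, MonoidAlgebra.coeff_smul_apply, hft,
        zero_sub, neg_ne_zero] at h1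
      have h2 := right_ne_zero_of_mul h1
      obtain ⟨v', rfl⟩ := exists_of_coeff_mon_mul_mul_mon_ne_zero h2
      rw [coeff_mon_mul_mul_mon] at h2
      rw [hab]
      refine (hv.2 v' h2 ?_).mul_mul a b
      rintro rfl
      exact htu hab.symm
    · exact hfu.2 t hft htu
  intro f hf
  by_cases hf0 : f = 0
  · rw [hf0]
    exact TwoSidedIdeal.zero_mem _
  obtain ⟨u, hu⟩ := exists_isLeadingMonomial hf0
  exact key u f hf hu

/-- A removed `f` still lies in the ideal, so its leading monomial would have to contain that of a
remaining element. -/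
theorem IsGroebnerBasis.isMinimal {G : Set (FreeAlg k α)} {I : TwoSidedIdeal (FreeAlg k α)}
    (hG : IsGroebnerBasis G I)
    (h : ∀ f ∈ G, ∀ g ∈ G, ∀ u v, IsLeadingMonomial f u → IsLeadingMonomial g v →
      IsSubword v u → g = f) : IsMinimalGroebnerBasis G I := by
  refine ⟨hG, fun f hf hG' => ?_⟩
  have hf0 : f ≠ 0 := by
    obtain ⟨u, hu, -⟩ := hG.monic f hf
    rintro rfl
    exact hu.1 rfl
  obtain ⟨g, hg, u, v, hu, hv, huv⟩ := hG'.leading f (hG.subset f hf) hf0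
  exact hg.2 (h f hf g hg.1 u v hu hv huv)

/-- Leading monomials of the two bases contain each other, and reducedness makes the matching go
back to `g`; so `g` has a partner `g'` with the same leading monomial. A nonzero `g - g'` would have
its leading monomial among the monomials of `g` or `g'`; this can only be the common leading one,
which cancels. -/
theorem IsReducedGroebnerBasis.subset_of_isReduced {G G' : Set (FreeAlg k α)}
    {I : TwoSidedIdeal (FreeAlg k α)} (hG : IsReducedGroebnerBasis G I)
    (hG' : IsReducedGroebnerBasis G' I) : G ⊆ G' := by
  intro g hg
  -- A non-leading monomial of a reduced element is never the leading monomial of an ideal element: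
  -- it contains no leading monomial of another basis element, and is too small to contain its own.
  have key : ∀ {G : Set (FreeAlg k α)}, IsReducedGroebnerBasis G I → ∀ {g}, g ∈ G →
      ∀ {u}, IsLeadingMonomial g u → ∀ {f t}, f ∈ I → IsLeadingMonomial f t →
      g.coeff t ≠ 0 → t = u := by
    intro G hG g hg u hu f t hf ht hgt
    have hf0 : f ≠ 0 := by
      rintro rfl
      exact ht.1 rfl
    obtain ⟨h, hh, t', v, ht', hv, hvt⟩ := hG.1.1.leading f hf hf0
    obtain rfl := ht.unique ht'
    by_cases hhg : h = g
    · subst hhg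
      by_contra htu
      obtain rfl := hu.unique hv
      exact hvt.not_degLexLT (hu.2 t hgt htu)
    · exact absurd hvt (hG.2 g hg t hgt h ⟨hh, hhg⟩ v hv)
  obtain ⟨u, hu, hgu⟩ := hG.1.1.monic g hg
  have hg0 : g ≠ 0 := by
    rintro rfl
    exact hu.1 rfl
  obtain ⟨g', hg', u', v, hu', hv, hvu⟩ := hG'.1.1.leading g (hG.1.1.subset g hg) hg0
  obtain rfl := hu.unique hu'
  have hg'0 : g' ≠ 0 := by
    rintro rfl
    exact hv.1 rfl
  obtain ⟨h, hh, v', t, hv', hht, htv⟩ := hG.1.1.leading g' (hG'.1.1.subset g' hg') hg'0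
  obtain rfl := hv.unique hv'
  have hhg : h = g := by
    by_contra hhg
    exact hG.2 g hg u hu.1 h ⟨hh, hhg⟩ t hht (htv.trans hvu)
  subst hhg
  obtain rfl := hu.unique hht
  obtain rfl := hvu.antisymm htv
  by_cases hd : h - g' = 0
  · rwa [sub_eq_zero.1 hd]
  exfalso
  obtain ⟨t, ht⟩ := exists_isLeadingMonomial hd
  have hI : h - g' ∈ I := I.sub_mem (hG.1.1.subset h hg) (hG'.1.1.subset g' hg')
  have htv : t = v := by
    by_cases h0 : h.coeff t = 0
    · refine key hG' hg' hv hI ht ?_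
      have := ht.1
      rwa [MonoidAlgebra.coeff_sub, Finsupp.sub_apply, h0, zero_sub, neg_ne_zero] at this
    · exact key hG hg hu hI ht h0
  subst htv
  refine ht.1 ?_
  rw [MonoidAlgebra.coeff_sub, Finsupp.sub_apply, hgu, (hG'.1.1.monic g' hg').coeff_eq_one hv,
    sub_self]

/-- A two-sided ideal has at most one reduced Gröbner basis. -/
theorem IsReducedGroebnerBasis.unique {G G' : Set (FreeAlg k α)}
    {I : TwoSidedIdeal (FreeAlg k α)} (hG : IsReducedGroebnerBasis G I)
    (hG' : IsReducedGroebnerBasis G' I) : G = G' :=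
  (hG.subset_of_isReduced hG').antisymm (hG'.subset_of_isReduced hG)

end Groebner

/-! ### Sorted lists, rearrangements and concatenation of blocks -/

section Lists

variable {α β : Type*} [LinearOrder β]

/-- Inequalities between distant blocks follow by transitivity through a letter of the block in
between; an empty block would break this. -/
theorem pairwise_flatMap_of_isChain {f : α → List β} (hne : ∀ a, f a ≠ [])
    (hf : ∀ a, (f a).Pairwise (· ≤ ·)) {l : List α}
    (h : l.IsChain fun a b => (f a ++ f b).Pairwise (· ≤ ·)) :
    (l.flatMap f).Pairwise (· ≤ ·) := by
  induction l with
  | nil => simp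
  | cons a l ih =>
    cases l with
    | nil => simpa using hf a
    | cons b l =>
      rw [List.isChain_cons_cons] at h
      have h2 := ih h.2
      rw [List.flatMap_cons, List.pairwise_append]
      refine ⟨hf a, h2, fun x hx y hy => ?_⟩
      have h1 := (List.pairwise_append.1 h.1).2.2
      rw [List.flatMap_cons] at hy h2
      rcases List.mem_append.1 hy with hy | hy
      · exact h1 x hx y hy
      · obtain ⟨c, hc⟩ := List.exists_mem_of_ne_nil _ (hne b)
        exact (h1 x hx c hc).trans ((List.pairwise_append.1 h2).2.2 c hc y hy)

variable [LinearOrder α]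

/-- At the first difference the sorted list shows the smallest letter still available, so no
rearrangement can show a smaller one. -/
theorem not_lex_of_perm_of_pairwise {l l' : List α} (h : l'.Perm l) (hl : l.Pairwise (· ≤ ·)) :
    ¬ List.Lex (· < ·) l' l := by
  intro hlex
  induction hlex with
  | nil => simpa using h.length_eq
  | cons _ ih => exact ih h.cons_inv (List.pairwise_cons.1 hl).2
  | rel hab =>
    rename_i a s b t
    rcases List.mem_cons.1 (h.subset List.mem_cons_self) with rfl | ha
    · exact lt_irrefl _ hab
    · exact hab.not_ge ((List.pairwise_cons.1 hl).1 a ha)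

theorem not_lex_of_forall_le {l l' : List α} (hlen : l.length = l'.length)
    (h : ∀ a ∈ l, ∀ b ∈ l', a ≤ b) : ¬ List.Lex (· < ·) l' l := by
  intro hlex
  induction hlex with
  | nil => simp at hlen
  | cons _ ih =>
    exact ih (by simpa using hlen) fun a ha b hb =>
      h a (List.mem_cons_of_mem _ ha) b (List.mem_cons_of_mem _ hb)
  | rel hab => exact hab.not_ge (h _ List.mem_cons_self _ List.mem_cons_self)

theorem lex_flatMap {f : α → List β} {d : ℕ} (hlen : ∀ a, (f a).length = d)
    (hf : ∀ a b, a < b → List.Lex (· < ·) (f a) (f b)) {l l' : List α}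
    (h : List.Lex (· < ·) l l') (hl : l.length = l'.length) :
    List.Lex (· < ·) (l.flatMap f) (l'.flatMap f) := by
  induction h with
  | nil => simp at hl
  | cons _ ih =>
    rw [List.flatMap_cons, List.flatMap_cons]
    exact List.Lex.append_left _ (ih (by simpa using hl)) _
  | rel hab =>
    rw [List.flatMap_cons, List.flatMap_cons]
    exact lex_append_of_length_eq (hf _ _ hab) ((hlen _).trans (hlen _).symm) _ _

end Lists

/-! ### Coefficients and leading monomials of binomials -/

section Binomials

variable {k α : Type*} [Field k]

theorem coeff_mon_self (u : FreeMonoid α) : (mon k u).coeff u = 1 := by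
  simp [mon]

theorem coeff_mon_of_ne {u v : FreeMonoid α} (h : u ≠ v) : (mon k u).coeff v = 0 := by
  rw [mon, MonoidAlgebra.coeff_single, Finsupp.single_eq_of_ne h.symm]

theorem linearMap_eq_of_support (L : FreeAlg k α →ₗ[k] k) (f : FreeAlg k α) (u : FreeMonoid α)
    (h : ∀ v, f.coeff v ≠ 0 → v ≠ u → L (mon k v) = 0) : L f = f.coeff u * L (mon k u) := by
  have hf : f = ∑ v ∈ f.coeff.support, f.coeff v • mon k v := by
    conv_lhs => rw [← MonoidAlgebra.sum_coeff_single f]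
    simp [Finsupp.sum, mon]
  conv_lhs => rw [hf]
  rw [map_sum, Finset.sum_eq_single u]
  · rw [map_smul, smul_eq_mul]
  · intro v hv hvu
    rw [map_smul, h v (Finsupp.mem_support_iff.1 hv) hvu, smul_zero]
  · intro hu
    rw [Finsupp.notMem_support_iff.1 hu, zero_smul, map_zero]

theorem mon_left_injective : Function.Injective (mon k : FreeMonoid α → FreeAlg k α) :=
  MonoidAlgebra.single_left_injective one_ne_zero

theorem eq_or_eq_of_coeff_binomial_ne_zero {u v t : FreeMonoid α} {c : k}
    (h : (mon k u - c • mon k v).coeff t ≠ 0) : t = u ∨ t = v := by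
  by_contra! h'
  refine h ?_
  rw [MonoidAlgebra.coeff_sub, Finsupp.sub_apply, MonoidAlgebra.coeff_smul_apply,
    coeff_mon_of_ne h'.1.symm, coeff_mon_of_ne h'.2.symm, smul_zero, sub_zero]

theorem of_mul_of_inj {a b c e : α}
    (h : FreeMonoid.of a * FreeMonoid.of b = FreeMonoid.of c * FreeMonoid.of e) :
    a = c ∧ b = e := by
  have := congrArg FreeMonoid.toList h
  simpa using this

theorem eq_of_isSubword_of_mul_of {a b c e : α}
    (h : IsSubword (FreeMonoid.of a * FreeMonoid.of b) (FreeMonoid.of c * FreeMonoid.of e)) :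
    a = c ∧ b = e :=
  of_mul_of_inj (h.eq_of_length_le (by simp))

variable [LinearOrder α]

theorem isLeadingMonomial_binomial {u v : FreeMonoid α} (h : DegLexLT v u) (c : k) :
    IsLeadingMonomial (mon k u - c • mon k v) u ∧ (mon k u - c • mon k v).coeff u = 1 := by
  have hvu : v ≠ u := by
    rintro rfl
    exact DegLexLT.irrefl _ h
  have h1 : (mon k u - c • mon k v).coeff u = 1 := by
    rw [MonoidAlgebra.coeff_sub, Finsupp.sub_apply, MonoidAlgebra.coeff_smul_apply,
      coeff_mon_self, coeff_mon_of_ne hvu, smul_zero, sub_zero]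
  refine ⟨⟨by rw [h1]; exact one_ne_zero, fun t ht htu => ?_⟩, h1⟩
  by_cases htv : v = t
  · rwa [← htv]
  · refine absurd ?_ ht
    rw [MonoidAlgebra.coeff_sub, Finsupp.sub_apply, MonoidAlgebra.coeff_smul_apply,
      coeff_mon_of_ne htu.symm, coeff_mon_of_ne htv, smul_zero, sub_zero]

end Binomials

/-! ### Sorting words, and the substitution `y_i ↦ w_i` -/

section Sorting

variable {m : ℕ}

theorem toList_sortedWord_perm (u : FreeMonoid (Fin m)) :
    (sortedWord u).toList.Perm u.toList := by
  simpa [sortedWord] using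
    Multiset.coe_eq_coe.1 (Multiset.sort_eq (u.toList : Multiset (Fin m)) (· ≤ ·))

theorem sortedWord_eq_of_perm {u v : FreeMonoid (Fin m)} (h : u.toList.Perm v.toList) :
    sortedWord u = sortedWord v := by
  rw [sortedWord, sortedWord, Multiset.coe_eq_coe.2 h]

theorem length_sortedWord (u : FreeMonoid (Fin m)) : (sortedWord u).length = u.length :=
  (toList_sortedWord_perm u).length_eq

end Sorting

section VeroneseWords

variable (n d : ℕ)

/-- The substitution `y_i ↦ w_i` on words. -/
noncomputable def wWord : FreeMonoid (Fin ((n + d).choose d)) →* FreeMonoid (Fin (n + 1)) :=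
  FreeMonoid.lift (w n d)

theorem wWord_of (i : Fin ((n + d).choose d)) : wWord n d (FreeMonoid.of i) = w n d i :=
  FreeMonoid.lift_eval_of _ _

theorem toList_wWord (u : FreeMonoid (Fin ((n + d).choose d))) :
    (wWord n d u).toList = u.toList.flatMap fun i => (w n d i).toList := by
  induction u using FreeMonoid.inductionOn' with
  | one => simp
  | of_mul i u ih => simp [wWord_of, ih]

theorem length_wWord (u : FreeMonoid (Fin ((n + d).choose d))) :
    (wWord n d u).length = u.length * d := by
  induction u using FreeMonoid.inductionOn' with
  | one => simp
  | of_mul i u ih =>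
    simp only [map_mul, FreeMonoid.length_mul, wWord_of, ih, w_length, FreeMonoid.length_of]
    ring

theorem lex_w {i j : Fin ((n + d).choose d)} (h : i < j) :
    List.Lex (· < ·) (w n d i).toList (w n d j).toList :=
  (List.shortlex_iff_lex ((w_length n d i).trans (w_length n d j).symm)).1 (w_degLexLT n d h)

theorem w_injective : Function.Injective (w n d) := fun i j h => by
  by_contra hij
  rcases lt_or_gt_of_ne hij with hij | hij
  · have := w_degLexLT n d hij
    rw [h] at this
    exact DegLexLT.irrefl _ this
  · have := w_degLexLT n d hij
    rw [h] at this
    exact DegLexLT.irrefl _ this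

theorem w_mul_w_inj {i j i' j' : Fin ((n + d).choose d)}
    (h : w n d i * w n d j = w n d i' * w n d j') : i = i' ∧ j = j' := by
  have h1 : (w n d i).toList ++ (w n d j).toList = (w n d i').toList ++ (w n d j').toList := by
    simpa using congrArg FreeMonoid.toList h
  have h2 := List.append_inj h1 ((w_length n d i).trans (w_length n d i').symm)
  exact ⟨w_injective n d (FreeMonoid.toList.injective h2.1),
    w_injective n d (FreeMonoid.toList.injective h2.2)⟩

variable {n d}

/-- Every letter of `w_i` is at most every letter of `w_j`. The condition `i ≤ j` in `InC` is thus
automatic. -/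
theorem le_of_isTerm_w_mul_w {i j : Fin ((n + d).choose d)} (h : IsTerm (w n d i * w n d j)) :
    i ≤ j := by
  by_contra! hij
  refine not_lex_of_forall_le ((w_length n d i).trans (w_length n d j).symm) ?_ (lex_w n d hij)
  rw [IsTerm, FreeMonoid.toList_mul] at h
  exact (List.pairwise_append.1 h).2.2

theorem inC_iff {i j : Fin ((n + d).choose d)} : InC i j ↔ IsTerm (w n d i * w n d j) :=
  ⟨fun h => h.2, fun h => ⟨le_of_isTerm_w_mul_w h, h⟩⟩

/-- Among the words whose images have the same multi-degree, the one whose image is a term is the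
least. -/
theorem eq_or_degLexLT_of_sortedWord_eq (hd : 1 ≤ d) {u v : FreeMonoid (Fin ((n + d).choose d))}
    (hu : IsTerm (wWord n d u)) (h : sortedWord (wWord n d v) = wWord n d u) :
    u = v ∨ DegLexLT u v := by
  by_contra! h'
  have hp : (wWord n d v).toList.Perm (wWord n d u).toList := by
    rw [← h]
    exact (toList_sortedWord_perm _).symm
  have hlen : v.length = u.length := by
    have := hp.length_eq
    change (wWord n d v).length = (wWord n d u).length at this
    rw [length_wWord, length_wWord] at this
    exact Nat.eq_of_mul_eq_mul_right hd this
  -- If `v` were smaller than `u`, its image would be a rearrangement of the sorted image of `u`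
  -- lying lexicographically below it.
  have hlex := (List.shortlex_iff_lex hlen).1 (degLexLT_of_ne_of_not (Ne.symm h'.1) h'.2)
  have := lex_flatMap (w_length n d) (fun _ _ => lex_w n d) hlex hlen
  rw [toList_wWord, toList_wWord] at hp
  rw [IsTerm, toList_wWord] at hu
  exact not_lex_of_perm_of_pairwise hp hu this

/-- For nonempty blocks sortedness can be tested on neighbouring blocks; `1 ≤ d` makes the `w_i`
nonempty. -/
theorem exists_not_inC_of_not_isTerm (hd : 1 ≤ d) {u : FreeMonoid (Fin ((n + d).choose d))}
    (hu : ¬ IsTerm (wWord n d u)) :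
    ∃ i j, ¬ InC i j ∧ IsSubword (FreeMonoid.of i * FreeMonoid.of j) u := by
  by_contra! h
  refine hu ?_
  rw [IsTerm, toList_wWord]
  refine pairwise_flatMap_of_isChain (fun i hi => ?_) (fun i => w_isTerm n d i) ?_
  · have := w_length n d i
    rw [FreeMonoid.length, hi, List.length_nil] at this
    omega
  · rw [List.isChain_iff_forall_rel_of_append_cons_cons]
    intro i j a b hab
    by_contra hij
    refine h i j (fun hC => hij ?_) ⟨FreeMonoid.ofList a, FreeMonoid.ofList b, ?_⟩
    · simpa [IsTerm] using hC.2
    · refine FreeMonoid.toList.injective ?_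
      simpa using hab

/-- The sorted word has length `2d`; its two halves are again terms of length `d`. -/
theorem exists_inC (i j : Fin ((n + d).choose d)) :
    ∃ i' j', InC i' j' ∧ sortedWord (w n d i * w n d j) = w n d i' * w n d j' := by
  set T := sortedWord (w n d i * w n d j) with hT
  have hlen : T.toList.length = d + d := by
    have := length_sortedWord (w n d i * w n d j)
    rwa [FreeMonoid.length_mul, w_length, w_length] at this
  have hT' : T.toList.Pairwise (· ≤ ·) := sortedWord_isTerm _
  obtain ⟨i', hi'⟩ := exists_w_eq n d (u := FreeMonoid.ofList (T.toList.take d))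
    (hT'.sublist (List.take_sublist _ _)) (by simp [FreeMonoid.length, hlen])
  obtain ⟨j', hj'⟩ := exists_w_eq n d (u := FreeMonoid.ofList (T.toList.drop d))
    (hT'.sublist (List.drop_sublist _ _)) (by simp [FreeMonoid.length, hlen])
  have h : T = w n d i' * w n d j' := by
    rw [hi', hj', ← FreeMonoid.ofList_append, List.take_append_drop, FreeMonoid.ofList_toList]
  exact ⟨i', j', inC_iff.2 (h ▸ sortedWord_isTerm _), h⟩

theorem degLexLT_of_sortedWord_eq (hd : 1 ≤ d) {i j i' j' : Fin ((n + d).choose d)}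
    (hij : ¬ InC i j) (hC : InC i' j')
    (h : sortedWord (w n d i * w n d j) = w n d i' * w n d j') :
    DegLexLT (FreeMonoid.of i' * FreeMonoid.of j') (FreeMonoid.of i * FreeMonoid.of j) := by
  rcases eq_or_degLexLT_of_sortedWord_eq hd (u := FreeMonoid.of i' * FreeMonoid.of j')
    (v := FreeMonoid.of i * FreeMonoid.of j) (by simpa [wWord_of] using hC.2)
    (by simpa [wWord_of] using h) with h | h
  · obtain ⟨rfl, rfl⟩ := of_mul_of_inj h
    exact absurd hC hij
  · exact h

/-- If `w_{i'} w_{i'}` is sorted, all its letters coincide, so its rearrangement `w_i w_j` is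
already a term. This makes `i' < j'` automatic in `Re₁` and `Re₂`. -/
theorem ne_of_sortedWord_eq {i j i' j' : Fin ((n + d).choose d)}
    (hij : ¬ InC i j) (hC : InC i' j')
    (h : sortedWord (w n d i * w n d j) = w n d i' * w n d j') : i' ≠ j' := by
  rintro rfl
  refine hij (inC_iff.2 ?_)
  have hp : ((w n d i).toList ++ (w n d j).toList).Perm
      ((w n d i').toList ++ (w n d i').toList) := by
    simpa [h] using (toList_sortedWord_perm (w n d i * w n d j)).symm
  have hC' := hC.2
  rw [IsTerm, FreeMonoid.toList_mul] at hC' ⊢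
  have hle := (List.pairwise_append.1 hC').2.2
  have hall : ∀ a ∈ (w n d i).toList ++ (w n d j).toList,
      ∀ b ∈ (w n d i).toList ++ (w n d j).toList, a ≤ b := by
    intro a ha b hb
    rw [hp.mem_iff, List.mem_append, or_self] at ha hb
    exact hle a ha b hb
  exact List.pairwise_iff_forall_sublist.2 fun {a b} hab =>
    hall a (hab.subset (by simp)) b (hab.subset (by simp))

end VeroneseWords

/-! ### The kernel `K` and its two Gröbner bases -/

section Kernel

variable {n : ℕ} (d : ℕ) (q : Matrix (Fin (n + 1)) (Fin (n + 1)) ℂ)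

/-- The homomorphism of free algebras induced by the substitution `y_i ↦ w_i`. -/
noncomputable def wAlgHom :
    FreeAlg ℂ (Fin ((n + d).choose d)) →ₐ[ℂ] FreeAlg ℂ (Fin (n + 1)) :=
  MonoidAlgebra.lift ℂ _ _ ((MonoidAlgebra.of ℂ _).comp (wWord n d))

theorem wAlgHom_mon (u : FreeMonoid (Fin ((n + d).choose d))) :
    wAlgHom d (mon ℂ u) = mon ℂ (wWord n d u) := by
  simp [wAlgHom, mon]

theorem veroneseLift_mon (u : FreeMonoid (Fin ((n + d).choose d))) :
    (veroneseLift d q (mon ℂ u) : QuantumSpace q) = proj q (mon ℂ (wWord n d u)) := by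
  induction u using FreeMonoid.inductionOn' with
  | one => simp [mon_one]
  | of_mul i u ih =>
    rw [mon_mul, map_mul, MulMemClass.coe_mul, ih, map_mul, mon_mul, map_mul, wWord_of]
    exact congrArg (· * _) (veroneseLift_gen d q i)

theorem veroneseLift_eq (f : FreeAlg ℂ (Fin ((n + d).choose d))) :
    (veroneseLift d q f : QuantumSpace q) = proj q (wAlgHom d f) := by
  induction f using freeAlg_induction with
  | zero => simp
  | add f g hf hg => rw [map_add, AddMemClass.coe_add, hf, hg, map_add, map_add]
  | smul c u => rw [map_smul, map_smul, map_smul, wAlgHom_mon, ← veroneseLift_mon]; rfl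

variable {d q}

/-- Normal forms vanish exactly on the quantum ideal, so membership becomes a computation in the
free algebra. -/
theorem mem_veroneseKer_iff (hq : ∀ i j, q i j ≠ 0) (f : FreeAlg ℂ (Fin ((n + d).choose d))) :
    f ∈ veroneseKer d q ↔ nor q (wAlgHom d f) = 0 := by
  rw [veroneseKer, TwoSidedIdeal.mem_ker, nor_eq_iff q hq, sub_zero, ← proj_eq_zero_iff,
    ← veroneseLift_eq, ZeroMemClass.coe_eq_zero]
  exact (and_iff_right (Submodule.zero_mem _)).symm

theorem phi_ne_zero (hq : ∀ i j, q i j ≠ 0) (i j : Fin ((n + d).choose d)) : phi q i j ≠ 0 :=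
  sortCoeffList_ne_zero q hq _

theorem nor_wAlgHom_gen_mul_gen (i j : Fin ((n + d).choose d)) :
    nor q (wAlgHom d (gen i * gen j)) =
      phi q i j • mon ℂ (sortedWord (w n d i * w n d j)) := by
  rw [gen, gen, ← mon_mul, wAlgHom_mon, map_mul, wWord_of, wWord_of, nor_w_mul_w]

theorem binomial_mem_veroneseKer (hq : ∀ i j, q i j ≠ 0) {i j i' j' : Fin ((n + d).choose d)}
    (hC : InC i' j') (h : sortedWord (w n d i * w n d j) = w n d i' * w n d j') :
    gen i * gen j - phi q i j • (gen i' * gen j') ∈ veroneseKer d q := by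
  rw [mem_veroneseKer_iff hq, map_sub, map_sub, map_smul, map_smul, nor_wAlgHom_gen_mul_gen,
    nor_wAlgHom_gen_mul_gen, h, sortedWord_of_isTerm _ hC.2, phi, phi, sortCoeff, sortCoeff,
    sortCoeffList_of_pairwise q _ hC.2, one_smul, sub_self]

/-- Both products sort to the same term, and `φ_{ji} / φ_{ij}` is the ratio of the resulting
coefficients. -/
theorem commutator_mem_veroneseKer (hq : ∀ i j, q i j ≠ 0) (i j : Fin ((n + d).choose d)) :
    gen j * gen i - veroneseMatrix d q j i • (gen i * gen j) ∈ veroneseKer d q := by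
  have h : sortedWord (w n d j * w n d i) = sortedWord (w n d i * w n d j) :=
    sortedWord_eq_of_perm (by simpa using List.perm_append_comm)
  rw [mem_veroneseKer_iff hq, map_sub, map_sub, map_smul, map_smul, nor_wAlgHom_gen_mul_gen,
    nor_wAlgHom_gen_mul_gen, h, smul_smul, veroneseMatrix, Matrix.of_apply,
    div_mul_cancel₀ _ (phi_ne_zero hq i j), sub_self]

/-- The image of the leading monomial of a nonzero element of the kernel is not a term. -/
theorem not_isTerm_of_isLeadingMonomial (hd : 1 ≤ d) (hq : ∀ i j, q i j ≠ 0)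
    {f : FreeAlg ℂ (Fin ((n + d).choose d))} (hf : f ∈ veroneseKer d q)
    {u : FreeMonoid (Fin ((n + d).choose d))} (hu : IsLeadingMonomial f u) :
    ¬ IsTerm (wWord n d u) := by
  intro ht
  -- `L` reads off the coefficient of the term `wWord n d u` in the normal form. It kills `f`, yet a
  -- monomial of `f` other than `u` contributing to it would be larger than `u`; hence `L f` is the
  -- leading coefficient.
  let L : FreeAlg ℂ (Fin ((n + d).choose d)) →ₗ[ℂ] ℂ :=
    Finsupp.lapply (wWord n d u) ∘ₗ (MonoidAlgebra.coeffLinearEquiv ℂ).toLinearMap ∘ₗ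
      nor q ∘ₗ (wAlgHom d).toLinearMap
  have hL : ∀ g, L g = (nor q (wAlgHom d g)).coeff (wWord n d u) := fun g => rfl
  have h0 : L f = 0 := by
    rw [hL, (mem_veroneseKer_iff hq f).1 hf]
    rfl
  rw [linearMap_eq_of_support L f u] at h0
  · rw [hL, wAlgHom_mon, nor_term q _ ht, coeff_mon_self, mul_one] at h0
    exact hu.1 h0
  · intro v hv hvu
    rw [hL, wAlgHom_mon, nor_mon, MonoidAlgebra.coeff_smul_apply, coeff_mon_of_ne, smul_zero]
    intro h
    rcases eq_or_degLexLT_of_sortedWord_eq hd ht h with h | h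
    · exact hvu h.symm
    · exact DegLexLT.irrefl _ (h.trans (hu.2 v hv hvu))

theorem isGroebnerBasis_veroneseKer (hd : 1 ≤ d) (hq : ∀ i j, q i j ≠ 0)
    {G : Set (FreeAlg ℂ (Fin ((n + d).choose d)))} (hsub : ∀ g ∈ G, g ∈ veroneseKer d q)
    (hmonic : ∀ g ∈ G, IsMonic g)
    (h : ∀ i j : Fin ((n + d).choose d), ¬ InC i j →
      ∃ g ∈ G, IsLeadingMonomial g (FreeMonoid.of i * FreeMonoid.of j)) :
    IsGroebnerBasis G (veroneseKer d q) := by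
  have hlead : ∀ f ∈ veroneseKer d q, f ≠ 0 → ∃ g ∈ G, ∃ u v,
      IsLeadingMonomial f u ∧ IsLeadingMonomial g v ∧ IsSubword v u := by
    intro f hf hf0
    obtain ⟨u, hu⟩ := exists_isLeadingMonomial hf0
    obtain ⟨i, j, hij, hs⟩ :=
      exists_not_inC_of_not_isTerm hd (not_isTerm_of_isLeadingMonomial hd hq hf hu)
    obtain ⟨g, hg, hgl⟩ := h i j hij
    exact ⟨g, hg, u, _, hu, hgl, hs⟩
  exact ⟨hsub, hmonic, span_eq_of_leading hsub hmonic hlead, hlead⟩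

theorem nor_eq_smul_iff (hq : ∀ i j, q i j ≠ 0) {i j : Fin ((n + d).choose d)}
    {T : FreeMonoid (Fin (n + 1))} :
    nor q (mon ℂ (w n d i * w n d j)) = phi q i j • mon ℂ T ↔
      sortedWord (w n d i * w n d j) = T := by
  rw [nor_w_mul_w]
  exact (smul_right_injective _ (phi_ne_zero hq i j)).eq_iff.trans mon_left_injective.eq_iff

/-- The inequality `i' < j'`, the nonvanishing of `φ` and the order condition all follow from the
rest, and the normal-form equation reduces to one between words. -/
theorem mem_Re₂_iff (hd : 1 ≤ d) (hq : ∀ i j, q i j ≠ 0)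
    {F : FreeAlg ℂ (Fin ((n + d).choose d))} :
    F ∈ Re₂ d q ↔ ∃ i j i' j', InMV i j ∧ InC i' j' ∧
      sortedWord (w n d i * w n d j) = w n d i' * w n d j' ∧
      F = gen i * gen j - phi q i j • (gen i' * gen j') := by
  constructor
  · rintro ⟨i, j, i', j', hij, -, hC, -, hnor, -, rfl⟩
    exact ⟨i, j, i', j', hij, hC, (nor_eq_smul_iff hq).1 hnor, rfl⟩
  · rintro ⟨i, j, i', j', hij, hC, h, rfl⟩
    have hn : ¬ InC i j := fun h => hij.2 h.2
    exact ⟨i, j, i', j', hij, lt_of_le_of_ne hC.1 (ne_of_sortedWord_eq hn hC h), hC,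
      phi_ne_zero hq i j, (nor_eq_smul_iff hq).2 h, degLexLT_of_sortedWord_eq hd hn hC h, rfl⟩

theorem mem_Re₁_iff (hd : 1 ≤ d) (hq : ∀ i j, q i j ≠ 0)
    {F : FreeAlg ℂ (Fin ((n + d).choose d))} :
    F ∈ Re₁ d q ↔ ∃ i j i' j', j < i ∧ InC i' j' ∧
      sortedWord (w n d i * w n d j) = w n d i' * w n d j' ∧
      F = gen i * gen j - phi q i j • (gen i' * gen j') := by
  constructor
  · rintro ⟨i, j, i', j', hij, -, hC, -, hnor, -, rfl⟩
    exact ⟨j, i, i', j', hij, hC, (nor_eq_smul_iff hq).1 hnor, rfl⟩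
  · rintro ⟨i, j, i', j', hij, hC, h, rfl⟩
    have hn : ¬ InC i j := fun h => hij.not_ge h.1
    exact ⟨j, i, i', j', hij, lt_of_le_of_ne hC.1 (ne_of_sortedWord_eq hn hC h), hC,
      phi_ne_zero hq i j, (nor_eq_smul_iff hq).2 h, degLexLT_of_sortedWord_eq hd hn hC h, rfl⟩

theorem not_inC_iff {i j : Fin ((n + d).choose d)} : ¬ InC i j ↔ j < i ∨ InMV i j := by
  rw [InC, InMV, ← not_le]
  tauto

theorem mem_Re₁_union_Re₂_iff (hd : 1 ≤ d) (hq : ∀ i j, q i j ≠ 0)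
    {F : FreeAlg ℂ (Fin ((n + d).choose d))} :
    F ∈ Re₁ d q ∪ Re₂ d q ↔ ∃ i j i' j', ¬ InC i j ∧ InC i' j' ∧
      sortedWord (w n d i * w n d j) = w n d i' * w n d j' ∧
      F = gen i * gen j - phi q i j • (gen i' * gen j') := by
  simp only [Set.mem_union, mem_Re₁_iff hd hq, mem_Re₂_iff hd hq, not_inC_iff, or_and_right,
    exists_or]

theorem isLeadingMonomial_gen_mul_gen_sub {m : ℕ} {i j i' j' : Fin m} (c : ℂ)
    (h : DegLexLT (FreeMonoid.of i' * FreeMonoid.of j') (FreeMonoid.of i * FreeMonoid.of j)) :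
    IsLeadingMonomial (gen i * gen j - c • (gen i' * gen j'))
        (FreeMonoid.of i * FreeMonoid.of j) ∧
      IsMonic (gen i * gen j - c • (gen i' * gen j')) := by
  have := isLeadingMonomial_binomial h c
  rw [mon_mul, mon_mul] at this
  exact ⟨this.1, _, this⟩

/-- Each pair outside `C` leads exactly one binomial, and each tail is a word from `C`, which is not
a leading monomial. -/
theorem isReducedGroebnerBasis_Re₁_union_Re₂ (hd : 1 ≤ d) (hq : ∀ i j, q i j ≠ 0) :
    IsReducedGroebnerBasis (Re₁ d q ∪ Re₂ d q) (veroneseKer d q) := by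
  have hlm : ∀ f ∈ Re₁ d q ∪ Re₂ d q, ∀ u, IsLeadingMonomial f u → ∃ i j i' j', ¬ InC i j ∧
      InC i' j' ∧ sortedWord (w n d i * w n d j) = w n d i' * w n d j' ∧
      u = FreeMonoid.of i * FreeMonoid.of j ∧
      f = gen i * gen j - phi q i j • (gen i' * gen j') := by
    intro f hf u hu
    obtain ⟨i, j, i', j', hij, hC, h, rfl⟩ := (mem_Re₁_union_Re₂_iff hd hq).1 hf
    exact ⟨i, j, i', j', hij, hC, h, hu.unique (isLeadingMonomial_gen_mul_gen_sub _
      (degLexLT_of_sortedWord_eq hd hij hC h)).1, rfl⟩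
  have hanti : ∀ f ∈ Re₁ d q ∪ Re₂ d q, ∀ g ∈ Re₁ d q ∪ Re₂ d q, ∀ u v,
      IsLeadingMonomial f u → IsLeadingMonomial g v → IsSubword v u → g = f := by
    intro f hf g hg u v hu hv hs
    obtain ⟨i, j, i', j', -, -, h, rfl, rfl⟩ := hlm f hf u hu
    obtain ⟨a, b, a', b', -, -, h', rfl, rfl⟩ := hlm g hg v hv
    obtain ⟨rfl, rfl⟩ := eq_of_isSubword_of_mul_of hs
    -- Equal leading words sort to the same term, which splits uniquely into blocks of length `d`;
    -- so the tails agree too.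
    obtain ⟨rfl, rfl⟩ := w_mul_w_inj n d (h'.symm.trans h)
    rfl
  refine ⟨IsGroebnerBasis.isMinimal (isGroebnerBasis_veroneseKer hd hq ?_ ?_ ?_) hanti, ?_⟩
  · intro g hg
    obtain ⟨i, j, i', j', hij, hC, h, rfl⟩ := (mem_Re₁_union_Re₂_iff hd hq).1 hg
    exact binomial_mem_veroneseKer hq hC h
  · intro g hg
    obtain ⟨i, j, i', j', hij, hC, h, rfl⟩ := (mem_Re₁_union_Re₂_iff hd hq).1 hg
    exact (isLeadingMonomial_gen_mul_gen_sub _ (degLexLT_of_sortedWord_eq hd hij hC h)).2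
  · intro i j hij
    obtain ⟨i', j', hC, h⟩ := exists_inC i j
    exact ⟨_, (mem_Re₁_union_Re₂_iff hd hq).2 ⟨i, j, i', j', hij, hC, h, rfl⟩,
      (isLeadingMonomial_gen_mul_gen_sub _ (degLexLT_of_sortedWord_eq hd hij hC h)).1⟩
  · intro f hf t ht g hg v hv hs
    obtain ⟨i, j, i', j', hij, hC, h, rfl⟩ := (mem_Re₁_union_Re₂_iff hd hq).1 hf
    have ht' := ht
    simp only [gen, ← mon_mul] at ht'
    rcases eq_or_eq_of_coeff_binomial_ne_zero ht' with rfl | rfl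
    · exact hg.2 (hanti _ hf g hg.1 _ v (isLeadingMonomial_gen_mul_gen_sub _
        (degLexLT_of_sortedWord_eq hd hij hC h)).1 hv hs)
    · obtain ⟨a, b, a', b', hab, -, -, rfl, -⟩ := hlm g hg.1 v hv
      obtain ⟨rfl, rfl⟩ := eq_of_isSubword_of_mul_of hs
      exact hab hC

/-- The commutation relations have the same leading words `y_j y_i`, `i < j`, as `Re₁`. Only
minimality is claimed: a tail `y_i y_j` with `(i, j) ∈ MV` is itself a leading word of `Re₂`. -/
theorem isMinimalGroebnerBasis_quantumRels_union_Re₂ (hd : 1 ≤ d) (hq : ∀ i j, q i j ≠ 0) :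
    IsMinimalGroebnerBasis (quantumRels (veroneseMatrix d q) ∪ Re₂ d q) (veroneseKer d q) := by
  have hrel : ∀ {i j : Fin ((n + d).choose d)}, i < j → DegLexLT
      (FreeMonoid.of i * FreeMonoid.of j) (FreeMonoid.of j * FreeMonoid.of i) := fun hij =>
    List.Shortlex.of_lex rfl (List.Lex.rel hij)
  have hRe : ∀ {i j i' j' : Fin ((n + d).choose d)}, InMV i j → InC i' j' →
      sortedWord (w n d i * w n d j) = w n d i' * w n d j' →
      DegLexLT (FreeMonoid.of i' * FreeMonoid.of j') (FreeMonoid.of i * FreeMonoid.of j) :=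
    fun hij hC h => degLexLT_of_sortedWord_eq hd (not_inC_iff.2 (Or.inr hij)) hC h
  refine IsGroebnerBasis.isMinimal (isGroebnerBasis_veroneseKer hd hq ?_ ?_ ?_) ?_
  · rintro g (⟨i, j, -, rfl⟩ | hg)
    · exact commutator_mem_veroneseKer hq i j
    · obtain ⟨i, j, i', j', -, hC, h, rfl⟩ := (mem_Re₂_iff hd hq).1 hg
      exact binomial_mem_veroneseKer hq hC h
  · rintro g (⟨i, j, hij, rfl⟩ | hg)
    · exact (isLeadingMonomial_gen_mul_gen_sub _ (hrel hij)).2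
    · obtain ⟨i, j, i', j', hij, hC, h, rfl⟩ := (mem_Re₂_iff hd hq).1 hg
      exact (isLeadingMonomial_gen_mul_gen_sub _ (hRe hij hC h)).2
  · intro i j hij
    rcases not_inC_iff.1 hij with hij | hij
    · exact ⟨_, Or.inl ⟨j, i, hij, rfl⟩, (isLeadingMonomial_gen_mul_gen_sub _ (hrel hij)).1⟩
    · obtain ⟨i', j', hC, h⟩ := exists_inC i j
      exact ⟨_, Or.inr ((mem_Re₂_iff hd hq).2 ⟨i, j, i', j', hij, hC, h, rfl⟩),
        (isLeadingMonomial_gen_mul_gen_sub _ (hRe hij hC h)).1⟩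
  · intro f hf g hg u v hu hv hs
    rcases hf with ⟨i, j, hij, rfl⟩ | hf <;> rcases hg with ⟨a, b, hab, rfl⟩ | hg
    · obtain rfl := hu.unique (isLeadingMonomial_gen_mul_gen_sub _ (hrel hij)).1
      obtain rfl := hv.unique (isLeadingMonomial_gen_mul_gen_sub _ (hrel hab)).1
      obtain ⟨rfl, rfl⟩ := eq_of_isSubword_of_mul_of hs
      rfl
    · obtain ⟨a, b, a', b', hab, hC, h, rfl⟩ := (mem_Re₂_iff hd hq).1 hg
      obtain rfl := hu.unique (isLeadingMonomial_gen_mul_gen_sub _ (hrel hij)).1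
      obtain rfl := hv.unique (isLeadingMonomial_gen_mul_gen_sub _ (hRe hab hC h)).1
      obtain ⟨rfl, rfl⟩ := eq_of_isSubword_of_mul_of hs
      -- Leading words of the commutation relations have decreasing indices, those of `Re₂` weakly
      -- increasing ones.
      exact absurd hij hab.1.not_gt
    · obtain ⟨i, j, i', j', hij, hC, h, rfl⟩ := (mem_Re₂_iff hd hq).1 hf
      obtain rfl := hu.unique (isLeadingMonomial_gen_mul_gen_sub _ (hRe hij hC h)).1
      obtain rfl := hv.unique (isLeadingMonomial_gen_mul_gen_sub _ (hrel hab)).1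
      obtain ⟨rfl, rfl⟩ := eq_of_isSubword_of_mul_of hs
      exact absurd hab hij.1.not_gt
    · obtain ⟨i, j, i', j', hij, hC, h, rfl⟩ := (mem_Re₂_iff hd hq).1 hf
      obtain ⟨a, b, a', b', hab, hC', h', rfl⟩ := (mem_Re₂_iff hd hq).1 hg
      obtain rfl := hu.unique (isLeadingMonomial_gen_mul_gen_sub _ (hRe hij hC h)).1
      obtain rfl := hv.unique (isLeadingMonomial_gen_mul_gen_sub _ (hRe hab hC' h')).1
      obtain ⟨rfl, rfl⟩ := eq_of_isSubword_of_mul_of hs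
      obtain ⟨rfl, rfl⟩ := w_mul_w_inj n d (h'.symm.trans h)
      rfl

end Kernel

end QuantumVeronese

theorem mainTheorem3 (n d : ℕ) (hd : 1 ≤ d) (q : Matrix (Fin (n + 1)) (Fin (n + 1)) ℂ)
    (hq : QuantumVeronese.IsMultAntisymm q) :
    (QuantumVeronese.IsReducedGroebnerBasis
        (QuantumVeronese.Re₁ d q ∪ QuantumVeronese.Re₂ d q) (QuantumVeronese.veroneseKer d q) ∧
      ∀ G, QuantumVeronese.IsReducedGroebnerBasis G (QuantumVeronese.veroneseKer d q) →
        G = QuantumVeronese.Re₁ d q ∪ QuantumVeronese.Re₂ d q) ∧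
    QuantumVeronese.IsMinimalGroebnerBasis
      (QuantumVeronese.quantumRels (QuantumVeronese.veroneseMatrix d q) ∪
        QuantumVeronese.Re₂ d q)
      (QuantumVeronese.veroneseKer d q) := by
  have h := QuantumVeronese.isReducedGroebnerBasis_Re₁_union_Re₂ hd hq.1
  exact ⟨⟨h, fun G hG => hG.unique h⟩,
    QuantumVeronese.isMinimalGroebnerBasis_quantumRels_union_Re₂ hd hq.1⟩
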